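/- Let $N\ge 0$, and let $x_0,x_1,\dots,x_N$ be random vectors in $\mathbb{R}^d$ on a common probability space that are jointly Gaussian (not necessarily zero-mean, and possibly singular: no covariance matrix is assumed to be invertible). Let $C_{k,i}=\operatorname{Cov}(x_k,x_i)\in\mathbb{R}^{d\times d}$ be their covariance function. The sequence is called reciprocal if for all $0\le j<l\le N$ the family $(x_k)_{j<k<l}$ and the family $(x_k)_{k<j \text{ or } k>l}$ are conditionally independent given $(x_j,x_l)$. For $i,j,k,l\in\{0,\dots,N\}$ consider the identity $$C_{k,i}=\begin{bmatrix} C_{k,j} & C_{k,l}\end{bmatrix}\begin{bmatrix} C_{j,j} & C_{j,l}\\ C_{l,j} & C_{l,l}\end{bmatrix}^{+}\begin{bmatrix} C_{j,i}\\ C_{l,i}\end{bmatrix},\qquad (\ast)$$ where $M^+$ is the Moore--Penrose inverse of $M$. Then the following three conditions are equivalent: 1. the sequence is reciprocal; 2. $(\ast)$ holds (a) for all $i,j,k,l\in\{0,\dots,N\}$ with $l<i<j<k$, and (b) for $l=N$ and all $i<j<k$ in $\{0,\dots,N-1\}$; 3. $(\ast)$ holds (a) for all $i,j,k,l\in\{0,\dots,N\}$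 with $i<j<k<l$, and (b) for $l=0$ and all $i<j<k$ in $\{1,\dots,N\}$. -/

import Mathlib

section MoorePenrose

open Matrix

/-- The four Penrose equations: `B` is a Moore-Penrose inverse of the real matrix `A`. -/
structure IsMoorePenroseInverse {m n : Type*} [Fintype m] [Fintype n]
    (A : Matrix m n ℝ) (B : Matrix n m ℝ) : Prop where
  mul_mul_self : A * B * A = A
  mul_mul_inv : B * A * B = B
  transpose_mul_inv : (A * B)ᵀ = A * B
  transpose_inv_mul : (B * A)ᵀ = B * A

/-- A real matrix has at most one Moore-Penrose inverse. -/
theorem IsMoorePenroseInverse.unique {m n : Type*} [Fintype m] [Fintype n]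
    {A : Matrix m n ℝ} {B B' : Matrix n m ℝ}
    (h : IsMoorePenroseInverse A B) (h' : IsMoorePenroseInverse A B') : B = B' := by
  have e1 : A * B = A * B' := by
    calc A * B = (A * B)ᵀ := h.transpose_mul_inv.symm
      _ = ((A * B') * (A * B))ᵀ := by
          rw [← Matrix.mul_assoc, h'.mul_mul_self]
      _ = (A * B) * (A * B') := by
          rw [transpose_mul, h.transpose_mul_inv, h'.transpose_mul_inv]
      _ = A * B' := by rw [← Matrix.mul_assoc, h.mul_mul_self]
  have e2 : B * A = B' * A := by
    calc B * A = (B * A)ᵀ := h.transpose_inv_mul.symm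
      _ = ((B * A) * (B' * A))ᵀ := by
          rw [Matrix.mul_assoc B A, ← Matrix.mul_assoc A, h'.mul_mul_self]
      _ = (B' * A) * (B * A) := by
          rw [transpose_mul, h.transpose_inv_mul, h'.transpose_inv_mul]
      _ = B' * A := by rw [Matrix.mul_assoc, ← Matrix.mul_assoc A, h.mul_mul_self]
  calc B = B * A * B := h.mul_mul_inv.symm
    _ = B' * (A * B) := by rw [e2, Matrix.mul_assoc]
    _ = B' * A * B' := by rw [e1, Matrix.mul_assoc]
    _ = B' := h'.mul_mul_inv

/-- Every real matrix has a Moore-Penrose inverse. -/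
theorem exists_isMoorePenroseInverse {m n : Type*} [Fintype m] [Fintype n]
    (A : Matrix m n ℝ) : ∃ B : Matrix n m ℝ, IsMoorePenroseInverse A B := by
  classical
  have hG : (Aᵀ * A).IsHermitian := by
    have := isHermitian_conjTranspose_mul_self A
    rwa [conjTranspose_eq_transpose_of_trivial] at this
  obtain ⟨P, hPt, hc, hGPG, hPGP⟩ : ∃ P : Matrix n n ℝ, Pᵀ = P ∧
      (P * (Aᵀ * A))ᵀ = P * (Aᵀ * A) ∧ (Aᵀ * A) * P * (Aᵀ * A) = Aᵀ * A ∧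
      P * (Aᵀ * A) * P = P := by
    let U : Matrix n n ℝ := hG.eigenvectorUnitary
    let D : (n → ℝ) → Matrix n n ℝ := fun v => U * diagonal v * Uᵀ
    have hU : Uᵀ * U = 1 := by
      have := Unitary.coe_star_mul_self hG.eigenvectorUnitary
      rwa [star_eq_conjTranspose, conjTranspose_eq_transpose_of_trivial] at this
    obtain ⟨e, hGD⟩ : ∃ e, Aᵀ * A = D e := by
      refine ⟨hG.eigenvalues, ?_⟩
      have := hG.spectral_theorem
      rw [Unitary.conjStarAlgAut_apply, star_eq_conjTranspose,
        conjTranspose_eq_transpose_of_trivial] at this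
      exact this
    have hD : ∀ v w, D v * D w = D (fun i => v i * w i) := by
      intro v w
      calc D v * D w = U * diagonal v * (Uᵀ * U) * diagonal w * Uᵀ := by
            simp only [D, Matrix.mul_assoc]
        _ = D (fun i => v i * w i) := by
            rw [hU, Matrix.mul_one, Matrix.mul_assoc U, diagonal_mul_diagonal]
    have hDt : ∀ v, (D v)ᵀ = D v := by
      intro v
      simp only [D, transpose_mul, transpose_transpose, diagonal_transpose, Matrix.mul_assoc]
    refine ⟨D (fun i => (e i)⁻¹), hDt _, ?_, ?_, ?_⟩
    · rw [hGD, hD, hDt]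
    · rw [hGD, hD, hD]
      congr 1; funext i
      exact mul_inv_mul_cancel _
    · rw [hGD, hD, hD]
      congr 1; funext i
      simpa using mul_inv_mul_cancel (e i)⁻¹
  have hA : A * (P * (Aᵀ * A) - 1) = 0 := by
    rw [← conjTranspose_mul_self_eq_zero, conjTranspose_eq_transpose_of_trivial, transpose_mul,
      Matrix.mul_assoc, ← Matrix.mul_assoc Aᵀ, Matrix.mul_sub, ← Matrix.mul_assoc (Aᵀ * A),
      hGPG, Matrix.mul_one, sub_self, Matrix.mul_zero]
  refine ⟨P * Aᵀ, ?_, ?_, ?_, ?_⟩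
  · have := hA
    rw [Matrix.mul_sub, Matrix.mul_one, sub_eq_zero] at this
    simpa only [Matrix.mul_assoc] using this
  · calc P * Aᵀ * A * (P * Aᵀ) = P * (Aᵀ * A) * P * Aᵀ := by simp only [Matrix.mul_assoc]
      _ = P * Aᵀ := by rw [hPGP]
  · simp only [transpose_mul, transpose_transpose, hPt, Matrix.mul_assoc]
  · rw [Matrix.mul_assoc, hc]

/-- The Moore-Penrose inverse of a real matrix. -/
noncomputable def mpInverse {m n : Type*} [Fintype m] [Fintype n]
    (A : Matrix m n ℝ) : Matrix n m ℝ :=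
  Classical.choose (exists_isMoorePenroseInverse A)

theorem mpInverse_spec {m n : Type*} [Fintype m] [Fintype n] (A : Matrix m n ℝ) :
    IsMoorePenroseInverse A (mpInverse A) :=
  Classical.choose_spec (exists_isMoorePenroseInverse A)

end MoorePenrose

section Sequences

open MeasureTheory ProbabilityTheory Matrix

/-- The σ-algebras `m₁` and `m₂` are conditionally independent given `m`:
`P(s ∩ t | m) = P(s | m) P(t | m)` almost surely for all events `s ∈ m₁` and `t ∈ m₂`.
(No standard Borel assumption is made on the underlying space.) -/
def CondIndepGiven {Ω : Type*} [MeasurableSpace Ω] (μ : Measure Ω)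
    (m m₁ m₂ : MeasurableSpace Ω) : Prop :=
  ∀ s t : Set Ω, MeasurableSet[m₁] s → MeasurableSet[m₂] t →
    μ⟦s ∩ t | m⟧ =ᵐ[μ] μ⟦s | m⟧ * μ⟦t | m⟧

/-- The σ-algebra generated by the states `x_k`, `k ∈ S`. -/
abbrev sigmaStates {Ω : Type*} {N d : ℕ} (x : Fin (N + 1) → Ω → (Fin d → ℝ))
    (S : Set (Fin (N + 1))) : MeasurableSpace Ω :=
  MeasurableSpace.comap (fun ω (k : S) => x k ω) inferInstance

/-- The sequence `x_0, …, x_N` of random vectors in `ℝ^d` is reciprocal: for all times `j < l`, the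
states strictly between `j` and `l` are jointly conditionally independent of the states strictly
before `j` and strictly after `l`, given `x_j` and `x_l`. -/
def IsReciprocal {Ω : Type*} [MeasurableSpace Ω] {N d : ℕ}
    (x : Fin (N + 1) → Ω → (Fin d → ℝ)) (μ : Measure Ω) : Prop :=
  ∀ j l : Fin (N + 1), j < l →
    CondIndepGiven μ (sigmaStates x {j, l})
      (sigmaStates x {k | j < k ∧ k < l}) (sigmaStates x {k | k < j ∨ l < k})

/-- The covariance function `C_{k,i} = Cov(x_k, x_i)`, a `d × d` matrix. -/
noncomputable def covFun {Ω : Type*} [MeasurableSpace Ω] {N d : ℕ}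
    (x : Fin (N + 1) → Ω → (Fin d → ℝ)) (μ : Measure Ω) (k i : Fin (N + 1)) :
    Matrix (Fin d) (Fin d) ℝ :=
  Matrix.of fun a b => cov[fun ω => x k ω a, fun ω => x i ω b; μ]

/-- The identity
`C_{k,i} = [C_{k,j} C_{k,l}] [C_{j,j} C_{j,l}; C_{l,j} C_{l,l}]⁺ [C_{j,i}; C_{l,i}]`
for a matrix-valued function `C` of two times. -/
def CovIdentity {N d : ℕ} (C : Fin (N + 1) → Fin (N + 1) → Matrix (Fin d) (Fin d) ℝ)
    (i j k l : Fin (N + 1)) : Prop :=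
  C k i = fromCols (C k j) (C k l) *
    mpInverse (fromBlocks (C j j) (C j l) (C l j) (C l l)) *
    fromRows (C j i) (C l i)

end Sequences

/-! Regress `x_k` on `(x_j, x_l)`. Even for singular covariances the coefficients built from the
Moore-Penrose inverse solve the normal equations, so the residual is uncorrelated with `x_j` and
`x_l`, and (∗) says exactly that it is uncorrelated with `x_i`. By joint Gaussianity uncorrelated
means independent. Hence reciprocity is equivalent to (∗) for all `j < k < l` and all `i` outside
`[j, l]` (`isReciprocal_iff_covIdentity`). One direction rebuilds the interior states from residuals
and boundary states; the other uses that conditional independence makes `f - E[f | x_j, x_l]`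
orthogonal to the outer states.

It remains to recover all these instances from the two smaller families. This is linear algebra: (∗)
is symmetric under `i ↔ k` and under `j ↔ l`, and it obeys a contraction rule
(`covIdentity_contraction`) that trades the endpoint `N` or `0` for an interior conditioning time.
-/

/-! ### Linear algebra of the covariance identity. -/

section CovarianceAlgebra

open Matrix

/-- The coefficient matrix of the linear regression of the `k`-th state on the `j`-th and `l`-th
states, computed from the covariance function `C`. -/
noncomputable def regressionCoeff {N d : ℕ}
    (C : Fin (N + 1) → Fin (N + 1) → Matrix (Fin d) (Fin d) ℝ) (j l k : Fin (N + 1)) :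
    Matrix (Fin d) (Fin d ⊕ Fin d) ℝ :=
  fromCols (C k j) (C k l) * mpInverse (fromBlocks (C j j) (C j l) (C l j) (C l l))

/-- The matrix-valued function `C` is symmetric and satisfies the normal equations of the linear
regression on any two states. -/
structure SatisfiesNormalEquations {N d : ℕ}
    (C : Fin (N + 1) → Fin (N + 1) → Matrix (Fin d) (Fin d) ℝ) : Prop where
  transpose_eq : ∀ k i, (C k i)ᵀ = C i k
  normal_eq : ∀ j l k, regressionCoeff C j l k * fromBlocks (C j j) (C j l) (C l j) (C l l) =
    fromCols (C k j) (C k l)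

namespace SatisfiesNormalEquations

variable {N d : ℕ} {C : Fin (N + 1) → Fin (N + 1) → Matrix (Fin d) (Fin d) ℝ}
  (hC : SatisfiesNormalEquations C) {i j k l n : Fin (N + 1)}
include hC

theorem exists_coeff (j l k : Fin (N + 1)) : ∃ P Q : Matrix (Fin d) (Fin d) ℝ,
    C k j = P * C j j + Q * C l j ∧ C k l = P * C j l + Q * C l l := by
  refine ⟨(regressionCoeff C j l k).toCols₁, (regressionCoeff C j l k).toCols₂, ?_⟩
  have h := hC.normal_eq j l k
  rw [← fromCols_toCols (regressionCoeff C j l k), fromCols_mul_fromBlocks] at h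
  obtain ⟨h1, h2⟩ := fromCols_inj h
  exact ⟨h1.symm, h2.symm⟩

/-- Solutions of the normal equations need not be unique when the block matrix `M` is singular, but
the prediction is: the column `(C_{j,i}; C_{l,i})` lies in the range of `M`, by the normal equations
for `i`, and two solutions agree there because `M M⁺ M = M`. -/
theorem regressionCoeff_mul_fromRows (i : Fin (N + 1)) {P Q : Matrix (Fin d) (Fin d) ℝ}
    (h₁ : C k j = P * C j j + Q * C l j) (h₂ : C k l = P * C j l + Q * C l l) :
    regressionCoeff C j l k * fromRows (C j i) (C l i) = P * C j i + Q * C l i := by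
  set M := fromBlocks (C j j) (C j l) (C l j) (C l l) with hM
  have hMt : Mᵀ = M := by
    simp only [hM, fromBlocks_transpose, hC.transpose_eq]
  have hK : fromCols (C k j) (C k l) = fromCols P Q * M := by
    rw [hM, fromCols_mul_fromBlocks, ← h₁, ← h₂]
  have hc : fromRows (C j i) (C l i) = M * (regressionCoeff C j l i)ᵀ := by
    rw [← hMt, ← transpose_mul, hC.normal_eq, transpose_fromCols, hC.transpose_eq,
      hC.transpose_eq]
  calc regressionCoeff C j l k * fromRows (C j i) (C l i)
      = fromCols P Q * (M * mpInverse M * M) * (regressionCoeff C j l i)ᵀ := by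
        rw [hc, regressionCoeff, hK]; simp only [Matrix.mul_assoc, hM]
    _ = fromCols P Q * fromRows (C j i) (C l i) := by
        rw [(mpInverse_spec M).mul_mul_self, hc, Matrix.mul_assoc]
    _ = P * C j i + Q * C l i := fromCols_mul_fromRows ..

/-- Removes the pseudo-inverse: (∗) may be tested with any solution `(P, Q)` of the normal
equations. -/
theorem covIdentity_iff {P Q : Matrix (Fin d) (Fin d) ℝ}
    (h₁ : C k j = P * C j j + Q * C l j) (h₂ : C k l = P * C j l + Q * C l l) :
    CovIdentity C i j k l ↔ C k i = P * C j i + Q * C l i := by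
  rw [← hC.regressionCoeff_mul_fromRows i h₁ h₂]
  rfl

theorem covIdentity_swap (h : CovIdentity C i j k l) : CovIdentity C i l k j := by
  obtain ⟨P, Q, h₁, h₂⟩ := hC.exists_coeff j l k
  rw [hC.covIdentity_iff h₁ h₂] at h
  rw [add_comm] at h h₁ h₂
  exact (hC.covIdentity_iff h₂ h₁).2 h

/-- Substituting the normal equations for `k` into the transpose of (∗) turns it into the prediction
of `x_i`; conditional uncorrelatedness is symmetric. -/
theorem covIdentity_symm (h : CovIdentity C i j k l) : CovIdentity C k j i l := by
  obtain ⟨P, Q, h₁, h₂⟩ := hC.exists_coeff j l k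
  obtain ⟨R, S, h₃, h₄⟩ := hC.exists_coeff j l i
  rw [hC.covIdentity_iff h₁ h₂] at h
  rw [hC.covIdentity_iff h₃ h₄, ← hC.transpose_eq, h, ← hC.transpose_eq k j,
    ← hC.transpose_eq k l, h₁, h₂]
  simp only [transpose_add, transpose_mul, hC.transpose_eq, h₃, h₄, Matrix.mul_add,
    Matrix.add_mul, Matrix.mul_assoc]
  abel

/-- Contraction: if the `i`-th state is uncorrelated with the `k`-th and `l`-th ones given the
`j`-th and `n`-th ones, and the `k`-th state is uncorrelated with the `n`-th one given the `j`-th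
and `l`-th ones, then it is also uncorrelated with the `i`-th one. -/
theorem covIdentity_contraction (hk : CovIdentity C k j i n) (hl : CovIdentity C l j i n)
    (hn : CovIdentity C n j k l) : CovIdentity C i j k l := by
  obtain ⟨P, Q, h₁, h₂⟩ := hC.exists_coeff j l k
  obtain ⟨R, S, h₃, h₄⟩ := hC.exists_coeff j n i
  rw [hC.covIdentity_iff h₁ h₂] at hn ⊢
  rw [hC.covIdentity_iff h₃ h₄] at hk hl
  rw [← hC.transpose_eq, hk, ← hC.transpose_eq i j, ← hC.transpose_eq i l, h₃, hl]
  simp only [transpose_add, transpose_mul, hC.transpose_eq, h₁, hn, Matrix.mul_add,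
    Matrix.add_mul, Matrix.mul_assoc]
  abel

/-- Up to the symmetries, (a) is the case of an outer time to the right of `l`. For `i < j < k < l <
N`, (b) makes `x_i` uncorrelated with `x_k` and with `x_l` given `(x_j, x_N)`, and (a) makes `x_k`
uncorrelated with `x_N` given `(x_j, x_l)`; contraction with `n = N` replaces `x_N` by `x_l`. -/
theorem forall_covIdentity_iff_last :
    (∀ j l k i, j < l → j < k → k < l → (i < j ∨ l < i) → CovIdentity C i j k l) ↔
      (∀ i j k l : Fin (N + 1), l < i → i < j → j < k → CovIdentity C i j k l) ∧
      (∀ i j k : Fin (N + 1), i < j → j < k → k < Fin.last N →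
        CovIdentity C i j k (Fin.last N)) := by
  constructor
  · intro h
    refine ⟨fun i j k l hli hij hjk => ?_, fun i j k hij hjk hk => ?_⟩
    · exact hC.covIdentity_swap (hC.covIdentity_symm
        (h l j i k (hli.trans hij) hli hij (Or.inr hjk)))
    · exact h j _ k i (hjk.trans hk) hjk hk (Or.inl hij)
  · rintro ⟨ha, hb⟩
    have ha' : ∀ j l k i, j < k → k < l → l < i → CovIdentity C i j k l :=
      fun j l k i hjk hkl hli => hC.covIdentity_symm (hC.covIdentity_swap (ha k l i j hjk hkl hli))
    rintro j l k i hjl hjk hkl (hij | hli)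
    · rcases (Fin.le_last l).eq_or_lt with rfl | hl
      · exact hb i j k hij hjk hkl
      · exact hC.covIdentity_contraction (hC.covIdentity_symm (hb i j k hij hjk (hkl.trans hl)))
          (hC.covIdentity_symm (hb i j l hij hjl hl)) (ha' j l k _ hjk hkl hl)
    · exact ha' j l k i hjk hkl hli

/-- Time reversal of the previous argument: (a) covers outer times to the left of `j`, and
contraction with `n = 0` replaces `x_0` by `x_j`. -/
theorem forall_covIdentity_iff_zero :
    (∀ j l k i, j < l → j < k → k < l → (i < j ∨ l < i) → CovIdentity C i j k l) ↔
      (∀ i j k l : Fin (N + 1), i < j → j < k → k < l → CovIdentity C i j k l) ∧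
      (∀ i j k : Fin (N + 1), 0 < i → i < j → j < k → CovIdentity C i j k 0) := by
  constructor
  · intro h
    refine ⟨fun i j k l hij hjk hkl => ?_, fun i j k hi hij hjk => ?_⟩
    · exact h j l k i (hjk.trans hkl) hjk hkl (Or.inl hij)
    · exact hC.covIdentity_swap (hC.covIdentity_symm (h 0 j i k (hi.trans hij) hi hij (Or.inr hjk)))
  · rintro ⟨ha, hb⟩
    rintro j l k i hjl hjk hkl (hij | hli)
    · exact ha i j k l hij hjk hkl
    · rcases (Fin.zero_le j).eq_or_lt with rfl | hj
      · exact hC.covIdentity_swap (hC.covIdentity_symm (hb k l i hjk hkl hli))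
      · exact hC.covIdentity_swap (hC.covIdentity_contraction (hb k l i (hj.trans hjk) hkl hli)
          (hb j l i hj hjl hli) (hC.covIdentity_swap (ha 0 j k l hj hjk hkl)))

end SatisfiesNormalEquations

end CovarianceAlgebra

/-! ### Normal equations for possibly singular covariances. -/

section Regression

open MeasureTheory ProbabilityTheory Matrix

variable {Ω : Type*} [MeasurableSpace Ω] {μ : Measure Ω}

theorem covariance_eq_zero_of_variance_eq_zero [IsFiniteMeasure μ] {X Y : Ω → ℝ}
    (hX : MemLp X 2 μ) (h : Var[X; μ] = 0) : cov[X, Y; μ] = 0 := by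
  rw [covariance]
  refine integral_eq_zero_of_ae ?_
  filter_upwards [ae_eq_integral_of_variance_eq_zero hX h] with ω hω
  simp [hω]

/-- The cross-covariance matrix of two families of random variables. -/
noncomputable def covMatrix {α β : Type*} (Y : α → Ω → ℝ) (Z : β → Ω → ℝ) (μ : Measure Ω) :
    Matrix α β ℝ :=
  Matrix.of fun a b => cov[Y a, Z b; μ]

theorem covariance_regression_residual [IsFiniteMeasure μ] {α β : Type*} [Fintype β]
    {Y : α → Ω → ℝ} {Z : β → Ω → ℝ} (hY : ∀ a, MemLp (Y a) 2 μ) (hZ : ∀ b, MemLp (Z b) 2 μ)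
    (A : Matrix α β ℝ) {V : Ω → ℝ} (hV : MemLp V 2 μ) (a : α) :
    cov[fun ω => Y a ω - ∑ b, A a b * Z b ω, V; μ] =
      cov[Y a, V; μ] - ∑ b, A a b * cov[Z b, V; μ] := by
  have h : ∀ b, MemLp (fun ω => A a b * Z b ω) 2 μ := fun b => (hZ b).const_mul _
  rw [covariance_fun_sub_left (hY a) (memLp_finsetSum _ fun b _ => h b) hV,
    covariance_fun_sum_left h hV]
  simp only [covariance_const_mul_left]

/-- A vector `w` with `M w = 0` gives a combination `∑ w_b Z_b` of variance `wᵀ M w = 0`. It is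
almost surely constant, so uncorrelated with every `Y_a`: the cross-covariance vanishes on the
kernel of `M`. -/
theorem covMatrix_mul_mpInverse_mul [IsFiniteMeasure μ] {α β : Type*} [Fintype β]
    {Y : α → Ω → ℝ} {Z : β → Ω → ℝ} (hZ : ∀ b, MemLp (Z b) 2 μ) (hY : ∀ a, MemLp (Y a) 2 μ) :
    covMatrix Y Z μ * mpInverse (covMatrix Z Z μ) * covMatrix Z Z μ = covMatrix Y Z μ := by
  classical
  set M := covMatrix Z Z μ with hM
  -- The columns of `W` lie in the kernel of `M`, and the claim is that the cross-covariance
  -- annihilates them.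
  set W : Matrix β β ℝ := 1 - mpInverse M * M with hW
  have hMW : M * W = 0 := by
    rw [hW, Matrix.mul_sub, Matrix.mul_one, ← Matrix.mul_assoc, (mpInverse_spec M).mul_mul_self,
      sub_self]
  suffices h : covMatrix Y Z μ * W = 0 by
    rw [hW, Matrix.mul_sub, Matrix.mul_one, sub_eq_zero] at h
    rw [Matrix.mul_assoc, ← h]
  ext a c
  have hc : ∀ b, MemLp (fun ω => W b c * Z b ω) 2 μ := fun b => (hZ b).const_mul _
  have hlin : ∀ V : Ω → ℝ, MemLp V 2 μ →
      cov[fun ω => ∑ b, W b c * Z b ω, V; μ] = ∑ b, cov[V, Z b; μ] * W b c := by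
    intro V hV
    rw [covariance_fun_sum_left hc hV]
    refine Finset.sum_congr rfl fun b _ => ?_
    rw [covariance_const_mul_left, covariance_comm, mul_comm]
  have hsum : MemLp (fun ω => ∑ b, W b c * Z b ω) 2 μ := memLp_finsetSum _ fun b _ => hc b
  have hvar : Var[fun ω => ∑ b, W b c * Z b ω; μ] = 0 := by
    rw [← covariance_self hsum.aestronglyMeasurable.aemeasurable, covariance_fun_sum_left hc hsum]
    refine Finset.sum_eq_zero fun b _ => ?_
    rw [covariance_const_mul_left, covariance_comm, hlin _ (hZ b)]
    have := congr_fun (congr_fun hMW b) c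
    rw [Matrix.mul_apply] at this
    rw [show ∑ b', cov[Z b, Z b'; μ] * W b' c = 0 from this, mul_zero]
  rw [Matrix.mul_apply]
  exact (hlin _ (hY a)).symm.trans (covariance_eq_zero_of_variance_eq_zero hsum hvar)

end Regression

/-! ### Regression residuals of the sequence. -/

section CovFun

open MeasureTheory ProbabilityTheory Matrix

variable {Ω : Type*} [MeasurableSpace Ω] {μ : Measure Ω} {N d : ℕ}
  {x : Fin (N + 1) → Ω → (Fin d → ℝ)}

/-- The coordinates of the pair of states `(x_j, x_l)`. -/
def pairCoord (x : Fin (N + 1) → Ω → (Fin d → ℝ)) (j l : Fin (N + 1)) :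
    Fin d ⊕ Fin d → Ω → ℝ :=
  Sum.elim (fun a ω => x j ω a) (fun a ω => x l ω a)

theorem covMatrix_pairCoord (j l : Fin (N + 1)) :
    covMatrix (pairCoord x j l) (pairCoord x j l) μ =
      fromBlocks (covFun x μ j j) (covFun x μ j l) (covFun x μ l j) (covFun x μ l l) := by
  ext (a | a) (b | b) <;> rfl

theorem covMatrix_state_pairCoord (k j l : Fin (N + 1)) :
    covMatrix (fun a ω => x k ω a) (pairCoord x j l) μ =
      fromCols (covFun x μ k j) (covFun x μ k l) := by
  ext a (b | b) <;> rfl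

/-- The residual of the linear regression of the state `x_k` on the states `x_j` and `x_l`. -/
noncomputable def regressionResidual (x : Fin (N + 1) → Ω → (Fin d → ℝ)) (μ : Measure Ω)
    (j l k : Fin (N + 1)) (a : Fin d) (ω : Ω) : ℝ :=
  x k ω a - ∑ b, regressionCoeff (covFun x μ) j l k a b * pairCoord x j l b ω

theorem memLp_pairCoord (hx : ∀ k a, MemLp (fun ω => x k ω a) 2 μ) (j l : Fin (N + 1))
    (b : Fin d ⊕ Fin d) : MemLp (pairCoord x j l b) 2 μ := by
  rcases b with b | b
  exacts [hx j b, hx l b]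

theorem memLp_regressionResidual (hx : ∀ k a, MemLp (fun ω => x k ω a) 2 μ)
    (j l k : Fin (N + 1)) (a : Fin d) : MemLp (regressionResidual x μ j l k a) 2 μ :=
  (hx k a).sub (memLp_finsetSum _ fun b _ => (memLp_pairCoord hx j l b).const_mul _)

theorem satisfiesNormalEquations_covFun [IsFiniteMeasure μ]
    (hx : ∀ k a, MemLp (fun ω => x k ω a) 2 μ) : SatisfiesNormalEquations (covFun x μ) where
  transpose_eq k i := by
    ext a b
    exact covariance_comm _ _
  normal_eq j l k := by
    rw [regressionCoeff, ← covMatrix_pairCoord, ← covMatrix_state_pairCoord]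
    exact covMatrix_mul_mpInverse_mul (memLp_pairCoord hx j l) (hx k)

variable [IsFiniteMeasure μ] (hx : ∀ k a, MemLp (fun ω => x k ω a) 2 μ)
include hx

theorem covariance_regressionResidual_state (j l k i : Fin (N + 1)) (a b : Fin d) :
    cov[regressionResidual x μ j l k a, fun ω => x i ω b; μ] =
      (covFun x μ k i - regressionCoeff (covFun x μ) j l k *
        fromRows (covFun x μ j i) (covFun x μ l i)) a b := by
  refine (covariance_regression_residual (hx k) (memLp_pairCoord hx j l) _ (hx i b) a).trans ?_
  rw [Matrix.sub_apply, Matrix.mul_apply]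
  congr 1
  refine Finset.sum_congr rfl fun c _ => ?_
  rcases c with c | c <;> rfl

theorem covIdentity_iff_covariance_regressionResidual (i j k l : Fin (N + 1)) :
    CovIdentity (covFun x μ) i j k l ↔
      ∀ a b, cov[regressionResidual x μ j l k a, fun ω => x i ω b; μ] = 0 := by
  simp only [covariance_regressionResidual_state hx, ← Matrix.ext_iff, CovIdentity,
    Matrix.sub_apply, sub_eq_zero, regressionCoeff]

theorem covariance_regressionResidual_pairCoord (j l k : Fin (N + 1)) (a : Fin d)
    (b : Fin d ⊕ Fin d) :
    cov[regressionResidual x μ j l k a, pairCoord x j l b; μ] = 0 := by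
  refine (covariance_regression_residual (hx k) (memLp_pairCoord hx j l) _
    (memLp_pairCoord hx j l b) a).trans ?_
  have h := congr_fun (congr_fun ((satisfiesNormalEquations_covFun hx).normal_eq j l k) a) b
  rw [← covMatrix_pairCoord, ← covMatrix_state_pairCoord, Matrix.mul_apply] at h
  exact sub_eq_zero.2 h.symm

end CovFun

/-! ### Conditional independence from independence, and its orthogonality consequence. -/

section ConditionalIndependence

open MeasureTheory ProbabilityTheory

variable {Ω : Type*} {m m₁ m₂ mz mzy mΩ : MeasurableSpace Ω} {μ : Measure Ω}

theorem condIndepGiven_of_indepFun_of_eq_comap [IsProbabilityMeasure μ] {R Z Y : Type*}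
    [MeasurableSpace R] [MeasurableSpace Z] [MeasurableSpace Y] {r : Ω → R} {z : Ω → Z} {y : Ω → Y}
    (hr : Measurable r) (hz : Measurable z) (hy : Measurable y)
    (h : IndepFun r (fun ω => (z ω, y ω)) μ)
    (h₁ : m₁ ≤ MeasurableSpace.comap (fun ω => (r ω, z ω)) inferInstance)
    (h₂ : m₂ ≤ MeasurableSpace.comap y inferInstance)
    (hmz_eq : mz = MeasurableSpace.comap z inferInstance)
    (hmzy_eq : mzy = MeasurableSpace.comap (fun ω => (z ω, y ω)) inferInstance) :
    CondIndepGiven μ mz m₁ m₂ := by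
  intro s t hs ht
  obtain ⟨S, hS, rfl⟩ := h₁ s hs
  obtain ⟨T, hT, rfl⟩ := h₂ t ht
  set s := (fun ω => (r ω, z ω)) ⁻¹' S
  set t := y ⁻¹' T
  have hs : MeasurableSet s := (hr.prodMk hz) hS
  have ht : MeasurableSet t := hy hT
  have hzm : Measurable[mz] z := hmz_eq ▸ comap_measurable z
  have hzym : Measurable[mzy] fun ω => (z ω, y ω) := hmzy_eq ▸ comap_measurable _
  have hmz : mz ≤ mΩ := hmz_eq ▸ hz.comap_le
  have hmzy : mzy ≤ mΩ := hmzy_eq ▸ (hz.prodMk hy).comap_le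
  have hle : mz ≤ mzy := hmz_eq ▸ (measurable_fst.comp hzym).comap_le
  have htzy : MeasurableSet[mzy] t := (measurable_snd.comp hzym) hT
  have : IsProbabilityMeasure (μ.map r) := Measure.isProbabilityMeasure_map hr.aemeasurable
  -- `G c` is the probability of `(r, c) ∈ S` with `z` frozen at `c`. The next steps show that
  -- `G(z)` is the conditional probability of `s` given `(z, y)`; since it does not involve `y`, the
  -- tower property finishes.
  let G : Z → ℝ := fun c => (μ.map r).real ((fun a => (a, c)) ⁻¹' S)
  have hGm : Measurable G := (measurable_measure_prodMk_right hS).ennreal_toReal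
  have hGz : StronglyMeasurable[mz] (fun ω => G (z ω)) :=
    (hGm.comp hzm).stronglyMeasurable
  have hGb : ∀ c, ‖G c‖ ≤ 1 := fun c => by
    rw [Real.norm_of_nonneg measureReal_nonneg]; exact measureReal_le_one
  have hGi : Integrable (fun ω => G (z ω)) μ :=
    Integrable.of_bound (hGz.mono hmz).aestronglyMeasurable 1 (ae_of_all _ fun ω => hGb _)
  have hsi : Integrable (s.indicator fun _ => (1 : ℝ)) μ := (integrable_const 1).indicator hs
  have hti : Integrable (t.indicator fun _ => (1 : ℝ)) μ := (integrable_const 1).indicator ht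
  have key : (fun ω => G (z ω)) =ᵐ[μ] μ⟦s | mzy⟧ := by
    refine ae_eq_condExp_of_forall_setIntegral_eq hmzy hsi (fun _ _ _ => hGi.integrableOn) ?_
      (hGz.mono hle).aestronglyMeasurable
    intro E hE _
    rw [hmzy_eq] at hE
    obtain ⟨D, hD, rfl⟩ := hE
    have hD' : MeasurableSet ((fun ω => (z ω, y ω)) ⁻¹' D) := (hz.prodMk hy) hD
    have hE : MeasurableSet {p : R × Z × Y | (p.1, p.2.1) ∈ S ∧ p.2 ∈ D} :=
      ((measurable_fst.prodMk (measurable_fst.comp measurable_snd)) hS).inter (measurable_snd hD)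
    have hlaw := (indepFun_iff_map_prod_eq_prod_map_map hr.aemeasurable
      (hz.prodMk hy).aemeasurable).1 h
    rw [setIntegral_indicator hs, setIntegral_const, smul_eq_mul, mul_one]
    have e1 : μ.real ((fun ω => (z ω, y ω)) ⁻¹' D ∩ s) =
        (μ.map fun ω => (r ω, z ω, y ω)).real {p | (p.1, p.2.1) ∈ S ∧ p.2 ∈ D} := by
      rw [map_measureReal_apply (hr.prodMk (hz.prodMk hy)) hE]
      congr 1
      ext ω
      exact and_comm
    -- By independence the law of `(r, (z, y))` is a product, so Fubini integrates out `r` first.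
    rw [e1, hlaw, measureReal_def, Measure.prod_apply_symm hE,
      lintegral_map (measurable_measure_prodMk_right hE) (hz.prodMk hy),
      integral_eq_lintegral_of_nonneg_ae (ae_of_all _ fun ω => measureReal_nonneg)
        hGi.integrableOn.aestronglyMeasurable, ← lintegral_indicator hD']
    congr 1
    refine lintegral_congr fun ω => ?_
    by_cases hω : (z ω, y ω) ∈ D
    · rw [Set.indicator_of_mem (show ω ∈ (fun ω => (z ω, y ω)) ⁻¹' D from hω)]
      simp only [measureReal_def, ENNReal.ofReal_toReal (measure_ne_top _ _)]
      congr 1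
      ext a
      simp [hω]
    · rw [Set.indicator_of_notMem (show ω ∉ (fun ω => (z ω, y ω)) ⁻¹' D from hω)]
      simp [hω]
  have hst : (s ∩ t).indicator (fun _ => (1 : ℝ)) =
      s.indicator (fun _ => 1) * t.indicator (fun _ => 1) := by
    ext ω
    by_cases h1 : ω ∈ s <;> by_cases h2 : ω ∈ t <;> simp [h1, h2]
  have hsti : Integrable (s.indicator (fun _ => (1 : ℝ)) * t.indicator fun _ => 1) μ := by
    rw [← hst]; exact (integrable_const 1).indicator (hs.inter ht)
  have hGt : Integrable ((fun ω => G (z ω)) * t.indicator fun _ => (1 : ℝ)) μ :=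
    hti.bdd_mul (hGz.mono hmz).aestronglyMeasurable (ae_of_all _ fun ω => hGb _)
  have hts : StronglyMeasurable[mzy] (t.indicator fun _ => (1 : ℝ)) :=
    stronglyMeasurable_const.indicator htzy
  have e₁ : μ⟦s ∩ t | mz⟧ =ᵐ[μ] (fun ω => G (z ω)) * μ⟦t | mz⟧ :=
    calc μ⟦s ∩ t | mz⟧
        =ᵐ[μ] μ[μ[s.indicator (fun _ => (1 : ℝ)) * t.indicator (fun _ => 1) | mzy] | mz] := by
          rw [hst]; exact (condExp_condExp_of_le hle hmzy).symm
      _ =ᵐ[μ] μ[(fun ω => G (z ω)) * t.indicator (fun _ => 1) | mz] :=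
          condExp_congr_ae ((condExp_mul_of_stronglyMeasurable_right hts hsti hsi).trans
            (key.symm.mul (Filter.EventuallyEq.refl _ _)))
      _ =ᵐ[μ] (fun ω => G (z ω)) * μ⟦t | mz⟧ := condExp_mul_of_stronglyMeasurable_left hGz hGt hti
  have e₂ : μ⟦s | mz⟧ =ᵐ[μ] fun ω => G (z ω) :=
    calc μ⟦s | mz⟧ =ᵐ[μ] μ[μ⟦s | mzy⟧ | mz] := (condExp_condExp_of_le hle hmzy).symm
      _ =ᵐ[μ] μ[fun ω => G (z ω) | mz] := condExp_congr_ae key.symm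
      _ = fun ω => G (z ω) := condExp_of_stronglyMeasurable hmz hGz hGi
  exact e₁.trans (e₂.symm.mul (Filter.EventuallyEq.refl _ _))

/-- If `r` is independent of the pair `(z, y)`, then `(r, z)` and `y` are conditionally independent
given `z`. -/
theorem condIndepGiven_of_indepFun [IsProbabilityMeasure μ] {R Z Y : Type*}
    [MeasurableSpace R] [MeasurableSpace Z] [MeasurableSpace Y] {r : Ω → R} {z : Ω → Z} {y : Ω → Y}
    (hr : Measurable r) (hz : Measurable z) (hy : Measurable y)
    (h : IndepFun r (fun ω => (z ω, y ω)) μ)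
    (h₁ : m₁ ≤ MeasurableSpace.comap (fun ω => (r ω, z ω)) inferInstance)
    (h₂ : m₂ ≤ MeasurableSpace.comap y inferInstance) :
    CondIndepGiven μ (MeasurableSpace.comap z inferInstance) m₁ m₂ := by
  exact condIndepGiven_of_indepFun_of_eq_comap hr hz hy h h₁ h₂ rfl rfl

theorem integral_condExp_mul [IsFiniteMeasure μ] (hm : m ≤ mΩ) {f g : Ω → ℝ} (hf : Integrable f μ)
    (hg : StronglyMeasurable[m] g) (hfg : Integrable (f * g) μ) :
    ∫ ω, μ[f | m] ω * g ω ∂μ = ∫ ω, f ω * g ω ∂μ :=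
  (integral_congr_ae (condExp_mul_of_stronglyMeasurable_right hg hfg hf)).symm.trans
    (integral_condExp hm)

theorem norm_condExp_indicator_le_one [IsFiniteMeasure μ] (m : MeasurableSpace Ω) (s : Set Ω) :
    ∀ᵐ ω ∂μ, ‖(μ⟦s | m⟧) ω‖ ≤ 1 := by
  have h0 : 0 ≤ᵐ[μ] μ⟦s | m⟧ :=
    condExp_nonneg (ae_of_all _ fun ω => Set.indicator_nonneg (fun _ _ => zero_le_one) ω)
  have h1 : ∀ᵐ ω ∂μ, (μ⟦s | m⟧) ω ≤ 1 := condExp_le_nonneg_const zero_le_one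
    (ae_of_all _ fun ω => Set.indicator_le_self' (fun _ _ => zero_le_one) ω)
  filter_upwards [h0, h1] with ω h0 h1
  rwa [Real.norm_of_nonneg h0]

/-- Conditional expectations are self-adjoint. -/
theorem integral_mul_condExp_comm [IsFiniteMeasure μ] (hm : m ≤ mΩ) {f : Ω → ℝ} (hf : Integrable f μ) {t : Set Ω}
    (ht : MeasurableSet t) :
    ∫ ω, f ω * (μ⟦t | m⟧) ω ∂μ = ∫ ω in t, μ[f | m] ω ∂μ := by
  have hti : Integrable (t.indicator fun _ => (1 : ℝ)) μ := (integrable_const 1).indicator ht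
  have e1 := integral_condExp_mul hm hf (stronglyMeasurable_condExp (f := t.indicator fun _ => 1)
    (μ := μ) (m := m)) (hf.mul_bdd integrable_condExp.aestronglyMeasurable
      (norm_condExp_indicator_le_one m t))
  have hb : Integrable (t.indicator (fun _ => (1 : ℝ)) * μ[f | m]) μ := by
    refine integrable_condExp.bdd_mul (c := 1) hti.aestronglyMeasurable (ae_of_all _ fun ω => ?_)
    by_cases hω : ω ∈ t <;> simp [hω]
  have e2 := integral_condExp_mul hm hti (stronglyMeasurable_condExp (f := f)) hb
  rw [← e1, ← integral_indicator ht]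
  simp_rw [mul_comm (μ[f | m] _)]
  rw [e2]
  refine integral_congr_ae (ae_of_all _ fun ω => ?_)
  by_cases hω : ω ∈ t <;> simp [hω]

/-- If `m₁` and `m₂` are conditionally independent given `m`, then what remains of an
`m₁`-measurable variable after subtracting its conditional expectation given `m` is orthogonal to
the `m₂`-measurable variables. -/
theorem CondIndepGiven.integral_sub_condExp_mul_eq_zero [IsFiniteMeasure μ]
    (h : CondIndepGiven μ m m₁ m₂) (hm : m ≤ mΩ)
    (hm₁ : m₁ ≤ mΩ) (hm₂ : m₂ ≤ mΩ) {f g : Ω → ℝ}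
    (hf : Integrable f μ) (hfm : StronglyMeasurable[m₁] f) (hgm : StronglyMeasurable[m₂] g)
    (hfg : Integrable ((f - μ[f | m]) * g) μ) :
    ∫ ω, (f ω - μ[f | m] ω) * g ω ∂μ = 0 := by
  -- With `P_t = P(t | m)`, self-adjointness gives `∫_t E[f | m] = ∫ f P_t`. As `f` is
  -- `m₁`-measurable, `P_t` may be replaced by `E[P_t | m₁] = P(t | m₁)`, which yields `∫_t f`. No
  -- approximation of `f` by simple functions is needed.
  have key : ∀ t, MeasurableSet[m₂] t → ∫ ω in t, μ[f | m] ω ∂μ = ∫ ω in t, f ω ∂μ := by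
    intro t ht
    have hti : Integrable (t.indicator fun _ => (1 : ℝ)) μ :=
      (integrable_const 1).indicator (hm₂ t ht)
    -- Conditional independence enters here: for `s ∈ m₁`, `P(s ∩ t) = E[P(s | m) P(t | m)] = ∫_s
    -- P(t | m)`.
    have hproj : μ⟦t | m₁⟧ =ᵐ[μ] μ[μ⟦t | m⟧ | m₁] := by
      refine ae_eq_condExp_of_forall_setIntegral_eq hm₁ integrable_condExp
        (fun _ _ _ => integrable_condExp.integrableOn) (fun s hs _ => ?_)
        stronglyMeasurable_condExp.aestronglyMeasurable
      have hs' := hm₁ s hs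
      have ht' := hm₂ t ht
      have hsi : Integrable (s.indicator fun _ => (1 : ℝ)) μ := (integrable_const 1).indicator hs'
      calc ∫ ω in s, (μ⟦t | m₁⟧) ω ∂μ = ∫ ω in s, t.indicator (fun _ => (1 : ℝ)) ω ∂μ :=
            setIntegral_condExp hm₁ hti hs
        _ = ∫ ω, (s ∩ t).indicator (fun _ => (1 : ℝ)) ω ∂μ := by
            rw [setIntegral_indicator ht', integral_indicator (hs'.inter ht')]
        _ = ∫ ω, (μ⟦s ∩ t | m⟧) ω ∂μ := (integral_condExp hm).symm
        _ = ∫ ω, (μ⟦s | m⟧) ω * (μ⟦t | m⟧) ω ∂μ := integral_congr_ae (h s t hs ht)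
        _ = ∫ ω, s.indicator (fun _ => (1 : ℝ)) ω * (μ⟦t | m⟧) ω ∂μ :=
            integral_condExp_mul hm hsi stronglyMeasurable_condExp
              (hsi.mul_bdd integrable_condExp.aestronglyMeasurable
                (norm_condExp_indicator_le_one m t))
        _ = ∫ ω in s, (μ⟦t | m⟧) ω ∂μ := by
            rw [← integral_indicator hs']
            refine integral_congr_ae (ae_of_all _ fun ω => ?_)
            by_cases hω : ω ∈ s <;> simp [hω]
    have hb : Integrable (μ⟦t | m⟧ * f) μ :=
      hf.bdd_mul integrable_condExp.aestronglyMeasurable (norm_condExp_indicator_le_one m t)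
    have hb' : Integrable (t.indicator (fun _ => (1 : ℝ)) * f) μ := by
      refine hf.bdd_mul (c := 1) hti.aestronglyMeasurable (ae_of_all _ fun ω => ?_)
      by_cases hω : ω ∈ t <;> simp [hω]
    rw [← integral_mul_condExp_comm hm hf (hm₂ t ht)]
    simp_rw [mul_comm (f _)]
    rw [← integral_condExp_mul hm₁ integrable_condExp hfm hb, ← integral_indicator (hm₂ t ht)]
    calc ∫ ω, (μ[μ⟦t | m⟧ | m₁]) ω * f ω ∂μ = ∫ ω, (μ⟦t | m₁⟧) ω * f ω ∂μ :=
          integral_congr_ae (hproj.symm.mul (Filter.EventuallyEq.refl _ _))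
      _ = ∫ ω, t.indicator (fun _ => (1 : ℝ)) ω * f ω ∂μ := integral_condExp_mul hm₁ hti hfm hb'
      _ = ∫ ω, t.indicator f ω ∂μ := by
          refine integral_congr_ae (ae_of_all _ fun ω => ?_)
          by_cases hω : ω ∈ t <;> simp [hω]
  have hsub : Integrable (f - μ[f | m]) μ := hf.sub integrable_condExp
  have hzero : (0 : Ω → ℝ) =ᵐ[μ] μ[f - μ[f | m] | m₂] := by
    refine ae_eq_condExp_of_forall_setIntegral_eq hm₂ hsub
      (fun _ _ _ => integrableOn_zero) (fun t ht _ => ?_)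
      stronglyMeasurable_zero.aestronglyMeasurable
    simp only [Pi.zero_apply, integral_zero, Pi.sub_apply]
    rw [integral_sub hf.integrableOn integrable_condExp.integrableOn, key t ht, sub_self]
  refine (integral_condExp_mul hm₂ hsub hgm hfg).symm.trans ?_
  refine integral_eq_zero_of_ae ?_
  filter_upwards [hzero] with ω hω
  simp [← hω]

end ConditionalIndependence

/-! ### Reciprocity as a family of covariance identities. -/

section Reciprocal

open MeasureTheory ProbabilityTheory Matrix

variable {Ω : Type*} {mΩ : MeasurableSpace Ω} {μ : Measure Ω} {N d : ℕ}
  {x : Fin (N + 1) → Ω → (Fin d → ℝ)}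

theorem measurable_pairCoord (hx : ∀ k, Measurable (x k)) (j l : Fin (N + 1))
    (b : Fin d ⊕ Fin d) : Measurable (pairCoord x j l b) := by
  rcases b with b | b
  exacts [(measurable_pi_apply b).comp (hx j), (measurable_pi_apply b).comp (hx l)]

theorem measurable_regressionResidual (hx : ∀ k, Measurable (x k)) (j l k : Fin (N + 1))
    (a : Fin d) : Measurable (regressionResidual x μ j l k a) :=
  ((measurable_pi_apply a).comp (hx k)).sub
    (Finset.measurable_fun_sum _ fun b _ => (measurable_pairCoord hx j l b).const_mul _)

theorem sigmaStates_le (hx : ∀ k, Measurable (x k)) (S : Set (Fin (N + 1))) :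
    sigmaStates x S ≤ mΩ :=
  (measurable_pi_lambda _ fun k : S => hx k).comap_le

theorem measurable_sigmaStates {S : Set (Fin (N + 1))} {k : Fin (N + 1)} (hk : k ∈ S) :
    Measurable[sigmaStates x S] (x k) :=
  (measurable_pi_apply (⟨k, hk⟩ : S)).comp (comap_measurable fun ω (k : S) => x k ω)

theorem measurable_sigmaStates_pairCoord (j l : Fin (N + 1)) (b : Fin d ⊕ Fin d) :
    Measurable[sigmaStates x {j, l}] (pairCoord x j l b) := by
  rcases b with b | b
  exacts [(measurable_pi_apply b).comp (measurable_sigmaStates (by simp)),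
    (measurable_pi_apply b).comp (measurable_sigmaStates (by simp))]

theorem memLp_two_state (hG : IsGaussianProcess x μ) (k : Fin (N + 1)) (a : Fin d) :
    MemLp (fun ω => x k ω a) 2 μ :=
  ((hG.hasGaussianLaw_eval k).map
    (ContinuousLinearMap.proj (R := ℝ) (φ := fun _ : Fin d => ℝ) a)).memLp_two

/-- The residuals of the regressions on two states and the coordinates of the states are jointly
Gaussian, so that they are independent as soon as they are uncorrelated. -/
theorem indepFun_regressionResidual (hx : ∀ k, Measurable (x k)) (hG : IsGaussianProcess x μ)
    (j l : Fin (N + 1)) (S T : Set (Fin (N + 1)))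
    (h : ∀ k ∈ S, ∀ i ∈ T, ∀ a b,
      cov[regressionResidual x μ j l k a, fun ω => x i ω b; μ] = 0) :
    IndepFun (fun ω (p : S × Fin d) => regressionResidual x μ j l p.1 p.2 ω)
      (fun ω (q : T × Fin d) => x q.1 ω q.2) μ := by
  refine IsGaussianProcess.indepFun_of_covariance_eq_zero
    (X := fun (p : S × Fin d) ω => regressionResidual x μ j l p.1 p.2 ω)
    (Y := fun (q : T × Fin d) ω => x q.1 ω q.2) ?_
    (fun p => (measurable_regressionResidual hx j l p.1 p.2).aemeasurable)
    (fun q => ((measurable_pi_apply _).comp (hx _)).aemeasurable)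
    (fun p q => h p.1 p.1.2 q.1 q.1.2 p.2 q.2)
  -- Joint Gaussianity: residuals and coordinates are all continuous linear functionals of the whole
  -- sequence.
  refine hG.of_isGaussianProcess fun s => ⟨Finset.univ, ?_⟩
  have hcoord : ∀ (k : Fin (N + 1)) (a : Fin d),
      ∃ L : (↥(Finset.univ : Finset (Fin (N + 1))) → Fin d → ℝ) →L[ℝ] ℝ,
        ∀ ω, x k ω a = L (Finset.restrict Finset.univ (fun t => x t ω)) := fun k a =>
    ⟨(ContinuousLinearMap.proj (R := ℝ) (φ := fun _ : Fin d => ℝ) a).comp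
      (ContinuousLinearMap.proj (R := ℝ)
        (φ := fun _ : ↥(Finset.univ : Finset (Fin (N + 1))) => Fin d → ℝ) ⟨k, Finset.mem_univ k⟩),
      fun ω => rfl⟩
  have hpair : ∀ b, ∃ L : (↥(Finset.univ : Finset (Fin (N + 1))) → Fin d → ℝ) →L[ℝ] ℝ,
      ∀ ω, pairCoord x j l b ω = L (Finset.restrict Finset.univ (fun t => x t ω)) := by
    rintro (b | b)
    exacts [hcoord j b, hcoord l b]
  rcases s with ⟨k, a⟩ | ⟨i, a⟩
  · obtain ⟨L, hL⟩ := hcoord k a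
    choose P hP using hpair
    refine ⟨L - ∑ b, regressionCoeff (covFun x μ) j l k a b • P b, fun ω => ?_⟩
    simp [regressionResidual, hL, hP]
  · exact hcoord i a

theorem isReciprocal_of_covIdentity [IsProbabilityMeasure μ] (hx : ∀ k, Measurable (x k))
    (hG : IsGaussianProcess x μ)
    (h : ∀ j l k i, j < l → j < k → k < l → (i < j ∨ l < i) →
      CovIdentity (covFun x μ) i j k l) : IsReciprocal x μ := by
  intro j l hjl
  have hL := memLp_two_state hG
  set S : Set (Fin (N + 1)) := {k | j < k ∧ k < l}
  set E : Set (Fin (N + 1)) := {k | k < j ∨ l < k}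
  -- The boundary times are included because the residuals must be independent of boundary and outer
  -- states jointly, not of each separately.
  set T : Set (Fin (N + 1)) := {j, l} ∪ E
  have hind := indepFun_regressionResidual hx hG j l S T (by
    rintro k ⟨hjk, hkl⟩ i ((rfl | rfl) | hi) a b
    · exact covariance_regressionResidual_pairCoord hL i l k a (Sum.inl b)
    · exact covariance_regressionResidual_pairCoord hL j i k a (Sum.inr b)
    · exact (covIdentity_iff_covariance_regressionResidual hL i j k l).1
        (h j l k i hjl hjk hkl hi) a b)
  let φ : (T × Fin d → ℝ) → (({j, l} : Set (Fin (N + 1))) → Fin d → ℝ) × (E → Fin d → ℝ) :=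
    fun v => (fun k a => v (⟨k, Or.inl k.2⟩, a), fun k a => v (⟨k, Or.inr k.2⟩, a))
  have hφ : Measurable φ := by fun_prop
  refine condIndepGiven_of_indepFun
    (r := fun ω (p : S × Fin d) => regressionResidual x μ j l p.1 p.2 ω)
    (z := fun ω (k : ({j, l} : Set (Fin (N + 1)))) => x k ω) (y := fun ω (k : E) => x k ω)
    (measurable_pi_lambda _ fun p => measurable_regressionResidual hx j l p.1 p.2)
    (measurable_pi_lambda _ fun k => hx k) (measurable_pi_lambda _ fun k => hx k)
    (hind.comp measurable_id hφ) ?_ le_rfl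
  set r : Ω → (S × Fin d → ℝ) := fun ω p => regressionResidual x μ j l p.1 p.2 ω
  set z : Ω → (({j, l} : Set (Fin (N + 1))) → Fin d → ℝ) := fun ω k => x k ω
  let ψ : Fin d ⊕ Fin d → (({j, l} : Set (Fin (N + 1))) → Fin d → ℝ) → ℝ :=
    Sum.elim (fun b v => v ⟨j, by simp⟩ b) (fun b v => v ⟨l, by simp⟩ b)
  have hψ : ∀ b, Measurable (ψ b) := by
    rintro (b | b)
    · exact (measurable_pi_apply b).comp (measurable_pi_apply _)
    · exact (measurable_pi_apply b).comp (measurable_pi_apply _)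
  -- Recovers the interior states from residuals and boundary states by adding the regression back.
  let Θ : (S × Fin d → ℝ) × (({j, l} : Set (Fin (N + 1))) → Fin d → ℝ) → S → Fin d → ℝ :=
    fun v k a => v.1 (k, a) + ∑ b, regressionCoeff (covFun x μ) j l k a b * ψ b v.2
  have hΘ : Measurable Θ := by
    refine measurable_pi_lambda _ fun k => measurable_pi_lambda _ fun a => ?_
    exact ((measurable_pi_apply _).comp measurable_fst).add
      (Finset.measurable_fun_sum _ fun b _ => ((hψ b).comp measurable_snd).const_mul _)
  have hcomp : (fun ω (k : S) => x k ω) = Θ ∘ fun ω => (r ω, z ω) := by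
    ext ω k a
    have hb : ∀ b, ψ b (z ω) = pairCoord x j l b ω := by rintro (b | b) <;> rfl
    simp [Θ, hb, r, regressionResidual]
  rw [sigmaStates, hcomp, ← MeasurableSpace.comap_comp]
  exact MeasurableSpace.comap_mono hΘ.comap_le

theorem covIdentity_of_isReciprocal [IsProbabilityMeasure μ] (hx : ∀ k, Measurable (x k))
    (hG : IsGaussianProcess x μ) (h : IsReciprocal x μ) {i j k l : Fin (N + 1)} (hjl : j < l)
    (hjk : j < k) (hkl : k < l) (hi : i < j ∨ l < i) : CovIdentity (covFun x μ) i j k l := by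
  have hL := memLp_two_state hG
  rw [covIdentity_iff_covariance_regressionResidual hL]
  intro a b
  have hm : sigmaStates x {j, l} ≤ mΩ := sigmaStates_le hx _
  set ρ := regressionResidual x μ j l k a with hρ
  set q : Ω → ℝ := fun ω => ∑ b, regressionCoeff (covFun x μ) j l k a b * pairCoord x j l b ω
    with hq
  set f : Ω → ℝ := fun ω => x k ω a with hf
  set g : Ω → ℝ := fun ω => x i ω b
  have hρL : MemLp ρ 2 μ := memLp_regressionResidual hL j l k a
  have hqL : MemLp q 2 μ := memLp_finsetSum _ fun b _ => (memLp_pairCoord hL j l b).const_mul _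
  have hρi : Integrable ρ μ := hρL.integrable one_le_two
  have hqi : Integrable q μ := hqL.integrable one_le_two
  have hfi : Integrable f μ := (hL k a).integrable one_le_two
  have hgL : MemLp g 2 μ := hL i b
  have hfρq : f = ρ + q := by
    ext ω
    simp [hρ, hq, hf, regressionResidual]
  have hρm : Measurable ρ := measurable_regressionResidual hx j l k a
  have hqm : StronglyMeasurable[sigmaStates x {j, l}] q :=
    (Finset.measurable_fun_sum _ fun b _ =>
      (measurable_sigmaStates_pairCoord j l b).const_mul _).stronglyMeasurable
  have hind : IndepFun ρ (fun ω (n : ({j, l} : Set (Fin (N + 1)))) => x n ω) μ := by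
    have h0 := indepFun_regressionResidual hx hG j l {k} {j, l} (by
      rintro _ rfl n (rfl | rfl) a b
      · exact covariance_regressionResidual_pairCoord hL n l _ a (Sum.inl b)
      · exact covariance_regressionResidual_pairCoord hL j n _ a (Sum.inr b))
    have hφ : Measurable fun v : ({k} : Set (Fin (N + 1))) × Fin d → ℝ => v (⟨k, rfl⟩, a) :=
      measurable_pi_apply _
    have hψ : Measurable fun (v : ({j, l} : Set (Fin (N + 1))) × Fin d → ℝ)
        (n : ({j, l} : Set (Fin (N + 1)))) (c : Fin d) => v (n, c) := by fun_prop
    exact h0.comp hφ hψ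
  -- The mean of `ρ` appears because the regression has no intercept and the states need not be
  -- centred.
  have hcond : μ[f | sigmaStates x {j, l}] =ᵐ[μ] (fun _ => μ[ρ]) + q := by
    rw [hfρq]
    refine (condExp_add hρi hqi _).trans (Filter.EventuallyEq.add ?_ ?_)
    · exact condExp_indep_eq hρm.comap_le hm (comap_measurable ρ).stronglyMeasurable hind
    · rw [condExp_of_stronglyMeasurable hm hqm hqi]
  have hres : f - μ[f | sigmaStates x {j, l}] =ᵐ[μ] fun ω => ρ ω - μ[ρ] := by
    filter_upwards [hcond] with ω hω
    rw [Pi.sub_apply, hω, hfρq]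
    simp
  have hρg : Integrable (fun ω => ρ ω * g ω) μ := hρL.integrable_mul hgL
  have hρg' : Integrable (fun ω => (ρ ω - μ[ρ]) * g ω) μ :=
    (hρL.sub (memLp_const _)).integrable_mul hgL
  have h0 := (h j l hjl).integral_sub_condExp_mul_eq_zero hm (sigmaStates_le hx _)
    (sigmaStates_le hx _) (f := f) (g := g) hfi
    ((measurable_pi_apply a).comp (measurable_sigmaStates (S := {k | j < k ∧ k < l}) ⟨hjk, hkl⟩)).stronglyMeasurable
    ((measurable_pi_apply b).comp (measurable_sigmaStates (S := {k | k < j ∨ l < k}) hi)).stronglyMeasurable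
    (hρg'.congr (hres.symm.mul (Filter.EventuallyEq.refl _ _)))
  have h1 : ∫ ω, (ρ ω - μ[ρ]) * g ω ∂μ = 0 :=
    (integral_congr_ae (hres.symm.mul (Filter.EventuallyEq.refl _ g))).trans h0
  rw [covariance_eq_sub hρL hgL, ← h1]
  simp_rw [sub_mul]
  rw [integral_sub hρg ((hgL.integrable one_le_two).const_mul _), integral_const_mul]
  rfl

theorem isReciprocal_iff_covIdentity [IsProbabilityMeasure μ] (hx : ∀ k, Measurable (x k))
    (hG : IsGaussianProcess x μ) : IsReciprocal x μ ↔
      ∀ j l k i, j < l → j < k → k < l → (i < j ∨ l < i) → CovIdentity (covFun x μ) i j k l :=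
  ⟨fun h _ _ _ _ hjl hjk hkl hi => covIdentity_of_isReciprocal hx hG h hjl hjk hkl hi,
    isReciprocal_of_covIdentity hx hG⟩

end Reciprocal

theorem theorem4 {Ω : Type*} [MeasurableSpace Ω] (μ : MeasureTheory.Measure Ω)
    [MeasureTheory.IsProbabilityMeasure μ] (N d : ℕ)
    (x : Fin (N + 1) → Ω → (Fin d → ℝ)) (hx : ∀ k, Measurable (x k))
    (hG : ProbabilityTheory.IsGaussianProcess x μ) :
    (IsReciprocal x μ ↔
      (∀ i j k l : Fin (N + 1), l < i → i < j → j < k → CovIdentity (covFun x μ) i j k l) ∧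
      (∀ i j k : Fin (N + 1), i < j → j < k → k < Fin.last N →
        CovIdentity (covFun x μ) i j k (Fin.last N))) ∧
    (IsReciprocal x μ ↔
      (∀ i j k l : Fin (N + 1), i < j → j < k → k < l → CovIdentity (covFun x μ) i j k l) ∧
      (∀ i j k : Fin (N + 1), 0 < i → i < j → j < k →
        CovIdentity (covFun x μ) i j k 0)) := by
  have hC := satisfiesNormalEquations_covFun (memLp_two_state hG)
  have h := isReciprocal_iff_covIdentity hx hG
  exact ⟨h.trans hC.forall_covIdentity_iff_last, h.trans hC.forall_covIdentity_iff_zero⟩
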